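/- **Theorem (Deformation theorem for the second moment, additive case).** Let $N\ge 1$. A *GUE matrix* is a random Hermitian $N\times N$ matrix $X$ whose entries on and above the diagonal are independent centered Gaussians, real on the diagonal with variance $1/N$, and, above the diagonal, complex with independent real and imaginary parts of variance $1/(2N)$. For $s>0$ and $\tau\in\mathbb{C}$, write $Z_{s,\tau}$ for a *rotated elliptic matrix* with variance parameter $s$ and covariance parameter $\tau$, that is, a random $N\times N$ matrix $Z$ having the same distribution as $e^{i\theta}(aX+ibY)$, where $X,Y$ are independent GUE matrices and $\theta,a,b$ are real with $a,b$ not both zero, such that $$s=\mathbb{E}\Big\{\tfrac1N\operatorname{Trace}(Z^*Z)\Big\},\qquad \tau=\mathbb{E}\Big\{\tfrac1N\operatorname{Trace}(Z^*Z)\Big\}-\mathbb{E}\Big\{\tfrac1N\operatorname{Trace}(Z^2)\Big\}.$$ Let $s>0$ and let $\tau_0,\tau\in\mathbb{C}$ satisfy $|\tau_0-s|\le s$ and $|\tau-s|\le s$. Let $X_0$ be a random $N\times N$ complex matrix (not necessarily Hermitian) that is independent of $Z_{s,\tau_0}$ and independent of $Z_{s,\tau}$. Then, for every $z\in\mathbb{C}$,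 $$\mathbb{E}\Big\{\big|\det\big(z-(X_0+Z_{s,\tau})\big)\big|^2\Big\}=\mathbb{E}\left\{\left|\exp\Big(\frac{\tau-\tau_0}{2N}\frac{\partial^2}{\partial z^2}\Big)\det\big(z-(X_0+Z_{s,\tau_0})\big)\right|^2\right\},$$ where the exponential, applied to the polynomial $z\mapsto\det(z-(X_0+Z_{s,\tau_0}))$, is the terminating power series $\sum_{k\ge0}\frac{1}{k!}\big(\frac{\tau-\tau_0}{2N}\big)^k\frac{\partial^{2k}}{\partial z^{2k}}$. The expectations are taken in $[0,\infty]$, so no moment assumption on $X_0$ is needed. -/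

import Mathlib

open MeasureTheory ProbabilityTheory

noncomputable section

/-- The product (Borel) σ-algebra on complex matrices: a random matrix is measurable iff all of its
entries are. -/
instance matrixMeasurableSpace (N : ℕ) : MeasurableSpace (Matrix (Fin N) (Fin N) ℂ) :=
  inferInstanceAs (MeasurableSpace (Fin N → Fin N → ℂ))

/-- The Hermitian `N × N` matrix with real coordinates `g`: the diagonal entries are `g i i`, and
for `i < j` the `(i, j)` entry is `(g i j + √-1 * g j i) / √2`. -/
def hermitianOfCoords (N : ℕ) (g : Fin N × Fin N → ℝ) : Matrix (Fin N) (Fin N) ℂ :=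
  Matrix.of fun i j =>
    if i = j then (g (i, i) : ℂ)
    else if i < j then ((g (i, j) : ℂ) + Complex.I * (g (j, i) : ℂ)) / (Real.sqrt 2 : ℂ)
    else ((g (j, i) : ℂ) - Complex.I * (g (i, j) : ℂ)) / (Real.sqrt 2 : ℂ)

/-- The law of an `N × N` GUE matrix, normalized so that each entry has `E |X i j| ^ 2 = 1 / N`:
the coordinates are independent centered real Gaussians of variance `1 / N`. -/
def gueLaw (N : ℕ) : Measure (Matrix (Fin N) (Fin N) ℂ) :=
  (Measure.pi fun _ : Fin N × Fin N => gaussianReal 0 ((N : NNReal)⁻¹)).map (hermitianOfCoords N)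

/-- The law of `exp (i θ) (a X + i b Y)` for independent GUE matrices `X` and `Y`. -/
def rotatedEllipticLaw (N : ℕ) (θ a b : ℝ) : Measure (Matrix (Fin N) (Fin N) ℂ) :=
  ((gueLaw N).prod (gueLaw N)).map fun p =>
    Complex.exp (Complex.I * θ) • ((a : ℂ) • p.1 + (Complex.I * (b : ℂ)) • p.2)

/-- `Z` is a rotated elliptic random matrix with variance parameter `s` and covariance
parameter `τ`. -/
structure IsRotatedElliptic {Ω : Type*} [MeasurableSpace Ω] (P : Measure Ω) {N : ℕ}
    (Z : Ω → Matrix (Fin N) (Fin N) ℂ) (s : ℝ) (τ : ℂ) : Prop where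
  /-- `Z` has the distribution of `exp (i θ) (a X + i b Y)`, with `a`, `b` not both zero. -/
  hasLaw : ∃ θ a b : ℝ, (a ≠ 0 ∨ b ≠ 0) ∧ HasLaw Z (rotatedEllipticLaw N θ a b) P
  variance_eq : (s : ℂ) = ∫ ω, (1 / (N : ℂ)) * ((Z ω).conjTranspose * Z ω).trace ∂P
  covariance_eq : τ = (∫ ω, (1 / (N : ℂ)) * ((Z ω).conjTranspose * Z ω).trace ∂P)
      - ∫ ω, (1 / (N : ℂ)) * (Z ω ^ 2).trace ∂P

/-- The heat operator `exp (c ∂² / ∂z²)` on polynomials, as a terminating power series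
(the terms with `2 * k > natDegree p` vanish). -/
def heatOp (c : ℂ) (p : Polynomial ℂ) : Polynomial ℂ :=
  ∑ k ∈ Finset.range (p.natDegree + 1),
    (c ^ k / (Nat.factorial k : ℂ)) • (Polynomial.derivative^[2 * k] p)

end

/-! The expectation of a polynomial `f` in a centered Gaussian vector depends on its covariance `C`
only through `Δ f`, where `Δ = ∑ C a b ∂_a ∂_b`. A rotated elliptic matrix `Z` is Gaussian in its
entries and conjugate entries, and `|det (B + Z)| ^ 2` is a product of a determinant in the entries
and one in the conjugate entries. Passing from `τ₀` to `τ` changes `Δ` on the first factor by a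
multiple of `∑ ∂_{ij} ∂_{ji}`, which on determinants agrees with `-(∑ ∂_{ii}) ^ 2`, the operator of
a Gaussian multiple of the identity matrix; the second factor is treated in the same way. Hence the
change of parameter has the effect of shifting the two determinants by *independent* Gaussian
multiples of the identity. Shifting by `c • 1` translates `z` by `c`, and averaging a polynomial
over Gaussian translations is the heat operator. -/

noncomputable section

open Finset MvPolynomial

section CovLaplacian

variable {R ι ι' : Type*} [CommRing R]

theorem pderiv_comm (a b : ι) (f : MvPolynomial ι R) :
    pderiv a (pderiv b f) = pderiv b (pderiv a f) := by
  have h : ⁅(pderiv a : Derivation R (MvPolynomial ι R) (MvPolynomial ι R)),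
      (pderiv b : Derivation R (MvPolynomial ι R) (MvPolynomial ι R))⁆ = 0 := by
    classical
    refine MvPolynomial.derivation_ext fun i => ?_
    simp [Derivation.commutator_apply, pderiv_X, Pi.single_apply, apply_ite]
  rw [← sub_eq_zero, ← Derivation.commutator_apply, h, Derivation.zero_apply]

theorem pderiv_bind₁ [Fintype ι] (a : ι') (S : ι → MvPolynomial ι' R) (f : MvPolynomial ι R) :
    pderiv a (bind₁ S f) = ∑ b, pderiv a (S b) * bind₁ S (pderiv b f) := by
  classical
  induction f using MvPolynomial.induction_on with
  | C r => simp
  | add f g hf hg => simp [hf, hg, mul_add, sum_add_distrib]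
  | mul_X f i hf =>
    simp only [map_mul, bind₁_X_right, Derivation.leibniz, smul_eq_mul, hf, pderiv_X,
      Pi.single_apply, map_add, mul_add, sum_add_distrib, mul_sum, mul_left_comm (S i)]
    simp [apply_ite, mul_comm, mul_assoc]

theorem homogeneousComponent_pderiv (n : ℕ) (a : ι) (f : MvPolynomial ι R) :
    homogeneousComponent n (pderiv a f) = pderiv a (homogeneousComponent (n + 1) f) := by
  ext m
  simp [coeff_pderiv, coeff_homogeneousComponent, Finsupp.degree_single, ite_mul]

theorem pderiv_rename_of_notMem_range {e : ι → ι'} {a : ι'} (ha : a ∉ Set.range e)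
    (f : MvPolynomial ι R) : pderiv a (rename e f) = 0 :=
  pderiv_eq_zero_of_notMem_vars fun h =>
    let ⟨b, _, hb⟩ := mem_vars_rename e f h
    ha ⟨b, hb⟩

theorem pderiv_rename_inl (a : ι) (f : MvPolynomial ι R) :
    pderiv (Sum.inl a : ι ⊕ ι') (rename Sum.inl f) = rename Sum.inl (pderiv a f) :=
  pderiv_rename Sum.inl_injective a f

theorem pderiv_rename_inr (b : ι') (f : MvPolynomial ι' R) :
    pderiv (Sum.inr b : ι ⊕ ι') (rename Sum.inr f) = rename Sum.inr (pderiv b f) :=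
  pderiv_rename Sum.inr_injective b f

theorem pderiv_inl_rename_inr (a : ι) (f : MvPolynomial ι' R) :
    pderiv (Sum.inl a) (rename Sum.inr f) = 0 :=
  pderiv_rename_of_notMem_range (by simp) f

theorem pderiv_inr_rename_inl (b : ι') (f : MvPolynomial ι R) :
    pderiv (Sum.inr b) (rename Sum.inl f) = 0 :=
  pderiv_rename_of_notMem_range (by simp) f

theorem induction_on_rename_mul_rename {motive : MvPolynomial (ι ⊕ ι') R → Prop}
    (f : MvPolynomial (ι ⊕ ι') R) (add : ∀ f g, motive f → motive g → motive (f + g))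
    (mul : ∀ p q, motive (rename Sum.inl p * rename Sum.inr q)) : motive f := by
  induction f using MvPolynomial.induction_on' with
  | monomial m c =>
    have hm : m = (m.comapDomain Sum.inl Sum.inl_injective.injOn).mapDomain Sum.inl
        + (m.comapDomain Sum.inr Sum.inr_injective.injOn).mapDomain Sum.inr := by
      ext (a | b)
      · simp [Finsupp.mapDomain_apply Sum.inl_injective, Finsupp.mapDomain_of_notMem_range]
      · simp [Finsupp.mapDomain_apply Sum.inr_injective, Finsupp.mapDomain_of_notMem_range]
    have h := mul (monomial (m.comapDomain Sum.inl Sum.inl_injective.injOn) c)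
      (monomial (m.comapDomain Sum.inr Sum.inr_injective.injOn) 1)
    rwa [rename_monomial, rename_monomial, monomial_mul, mul_one, ← hm] at h
  | add f g hf hg => exact add f g hf hg

variable [Fintype ι] [Fintype ι']

/-- The second-order differential operator `∑ C a b ∂_a ∂_b`. When `C` is the covariance of a
centered Gaussian vector, half of it generates the corresponding heat flow on polynomials. -/
def covLaplacian (C : Matrix ι ι R) : MvPolynomial ι R →ₗ[R] MvPolynomial ι R :=
  ∑ a, ∑ b, C a b • (pderiv a).toLinearMap ∘ₗ (pderiv b).toLinearMap

theorem covLaplacian_apply (C : Matrix ι ι R) (f : MvPolynomial ι R) :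
    covLaplacian C f = ∑ a, ∑ b, C a b • pderiv a (pderiv b f) := by
  simp [covLaplacian]

theorem covLaplacian_add (C C' : Matrix ι ι R) :
    covLaplacian (C + C') = covLaplacian C + covLaplacian C' := by
  simp [covLaplacian, add_smul, sum_add_distrib]

theorem covLaplacian_smul (c : R) (C : Matrix ι ι R) :
    covLaplacian (c • C) = c • covLaplacian C := by
  simp [covLaplacian, mul_smul, smul_sum]

theorem covLaplacian_pderiv (C : Matrix ι ι R) (c : ι) (f : MvPolynomial ι R) :
    covLaplacian C (pderiv c f) = pderiv c (covLaplacian C f) := by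
  simp only [covLaplacian_apply, map_sum, Derivation.map_smul, pderiv_comm c]

theorem covLaplacian_comm (C C' : Matrix ι ι R) (f : MvPolynomial ι R) :
    covLaplacian C (covLaplacian C' f) = covLaplacian C' (covLaplacian C f) := by
  simp only [covLaplacian_apply C', map_sum, map_smul, covLaplacian_pderiv]

theorem isHomogeneous_covLaplacian (C : Matrix ι ι R) {n : ℕ} {f : MvPolynomial ι R}
    (hf : f.IsHomogeneous n) : (covLaplacian C f).IsHomogeneous (n - 2) := by
  rw [covLaplacian_apply]
  exact IsHomogeneous.sum _ _ _ fun a _ => IsHomogeneous.sum _ _ _ fun b _ =>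
    (homogeneousSubmodule ι R (n - 2)).smul_mem _ hf.pderiv.pderiv

theorem covLaplacian_homogeneousComponent (C : Matrix ι ι R) (n : ℕ) (f : MvPolynomial ι R) :
    covLaplacian C (homogeneousComponent (n + 2) f)
      = homogeneousComponent n (covLaplacian C f) := by
  simp only [covLaplacian_apply, map_sum, map_smul, homogeneousComponent_pderiv]

theorem covLaplacian_fromBlocks_diagonal (A : Matrix ι ι R) (D : Matrix ι' ι' R)
    (p : MvPolynomial ι R) (q : MvPolynomial ι' R) :
    covLaplacian (Matrix.fromBlocks A 0 0 D) (rename Sum.inl p * rename Sum.inr q)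
      = rename Sum.inl (covLaplacian A p) * rename Sum.inr q
        + rename Sum.inl p * rename Sum.inr (covLaplacian D q) := by
  simp [covLaplacian_apply, Derivation.leibniz, pderiv_rename_inl, pderiv_rename_inr,
    pderiv_inl_rename_inr, pderiv_inr_rename_inl, map_sum, sum_mul, mul_sum, mul_comm]

end CovLaplacian

section CenteredGaussian

variable {Ω Ω' ι ι' : Type*} [MeasurableSpace Ω] [MeasurableSpace Ω'] {μ : Measure Ω}
  {μ' : Measure Ω'} {Z : Ω → ι → ℂ} {Z' : Ω' → ι' → ℂ}

/-- All mixed moments of the complex random vector `Z` are finite. -/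
def HasFiniteMoments (Z : Ω → ι → ℂ) (μ : Measure Ω) : Prop :=
  ∀ f : MvPolynomial ι ℂ, Integrable (fun ω => eval (Z ω) f) μ

/-- The linear functional `f ↦ E (f Z)` on polynomials. -/
def HasFiniteMoments.expectation (hZ : HasFiniteMoments Z μ) :
    MvPolynomial ι ℂ →ₗ[ℂ] ℂ where
  toFun f := ∫ ω, eval (Z ω) f ∂μ
  map_add' f g := by
    simp only [map_add]
    exact integral_add (hZ f) (hZ g)
  map_smul' c f := by
    simp only [smul_eval]
    exact integral_const_mul c _

theorem HasFiniteMoments.expectation_apply (hZ : HasFiniteMoments Z μ)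
    (f : MvPolynomial ι ℂ) : hZ.expectation f = ∫ ω, eval (Z ω) f ∂μ := rfl

variable [Fintype ι] [Fintype ι'] {C : Matrix ι ι ℂ} {C' : Matrix ι' ι' ℂ}

/-- A complex random vector `Z` is centered Gaussian with covariance `C a b = E (Z a * Z b)` (no
complex conjugation) if it satisfies the Stein identity `E (Z a * f Z) = ∑ b, C a b * E (∂_b f Z)`
for all polynomials `f`, that is, if its moments are given by the Wick formula. -/
structure IsCenteredGaussian (Z : Ω → ι → ℂ) (C : Matrix ι ι ℂ) (μ : Measure Ω) : Prop where
  hasFiniteMoments : HasFiniteMoments Z μ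
  expectation_X_mul : ∀ (a : ι) (f : MvPolynomial ι ℂ), hasFiniteMoments.expectation (X a * f)
    = ∑ b, C a b * hasFiniteMoments.expectation (pderiv b f)

namespace IsCenteredGaussian

theorem integrable_mul (hZ : IsCenteredGaussian Z C μ) (a b : ι) :
    Integrable (fun ω => Z ω a * Z ω b) μ :=
  (hZ.hasFiniteMoments (X a * X b)).congr (.of_forall fun ω => by simp)

theorem integral_mul [IsProbabilityMeasure μ] (hZ : IsCenteredGaussian Z C μ) (a b : ι) :
    ∫ ω, Z ω a * Z ω b ∂μ = C a b := by
  classical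
  simpa [HasFiniteMoments.expectation_apply, pderiv_X, Pi.single_apply, apply_ite]
    using hZ.expectation_X_mul a (X b)

theorem expectation_covLaplacian (hZ : IsCenteredGaussian Z C μ) {n : ℕ} {f : MvPolynomial ι ℂ}
    (hf : f.IsHomogeneous n) : hZ.hasFiniteMoments.expectation (covLaplacian C f)
      = n * hZ.hasFiniteMoments.expectation f := by
  rw [← nsmul_eq_mul, ← map_nsmul, ← hf.sum_X_mul_pderiv]
  simp only [covLaplacian_apply, map_sum, map_smul, smul_eq_mul, hZ.expectation_X_mul]
  exact sum_congr rfl fun a _ => sum_congr rfl fun b _ => by rw [pderiv_comm a b]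

section Comparison

variable [IsProbabilityMeasure μ] [IsProbabilityMeasure μ'] {W : Ω' → ι → ℂ} {D : Matrix ι ι ℂ}

theorem expectation_eq_of_isHomogeneous (hZ : IsCenteredGaussian Z C μ)
    (hW : IsCenteredGaussian W D μ') {n : ℕ} {f : MvPolynomial ι ℂ} (hf : f.IsHomogeneous n)
    (hΔ : covLaplacian C f = covLaplacian D f) :
    hZ.hasFiniteMoments.expectation f = hW.hasFiniteMoments.expectation f := by
  induction n using Nat.strong_induction_on generalizing f with
  | _ n ih =>
    rcases Nat.eq_zero_or_pos n with rfl | hn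
    · rw [totalDegree_eq_zero_iff_eq_C.1 ((totalDegree_zero_iff_isHomogeneous ι).2 hf)]
      simp [HasFiniteMoments.expectation_apply]
    · have h := ih (n - 2) (by omega) (isHomogeneous_covLaplacian C hf) (by
        rw [covLaplacian_comm D, ← hΔ])
      rw [hZ.expectation_covLaplacian hf, hΔ, hW.expectation_covLaplacian hf] at h
      exact mul_left_cancel₀ (by exact_mod_cast hn.ne') h

theorem expectation_eq (hZ : IsCenteredGaussian Z C μ) (hW : IsCenteredGaussian W D μ')
    {f : MvPolynomial ι ℂ} (hΔ : covLaplacian C f = covLaplacian D f) :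
    hZ.hasFiniteMoments.expectation f = hW.hasFiniteMoments.expectation f := by
  have hΔn (n : ℕ) :
      covLaplacian C (homogeneousComponent n f) = covLaplacian D (homogeneousComponent n f) := by
    match n with
    | 0 => simp [covLaplacian_apply]
    | 1 => simp [covLaplacian_apply, ← homogeneousComponent_pderiv, homogeneousComponent_zero]
    | n + 2 => simp only [covLaplacian_homogeneousComponent, hΔ]
  rw [← sum_homogeneousComponent f, map_sum, map_sum]
  exact sum_congr rfl fun n _ =>
    hZ.expectation_eq_of_isHomogeneous hW (homogeneousComponent_isHomogeneous n f) (hΔn n)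

end Comparison

theorem comp (hZ : IsCenteredGaussian Z C μ) {T : Ω' → Ω} (hT : HasLaw T μ μ') :
    IsCenteredGaussian (Z ∘ T) C μ' := by
  have hmeas (f : MvPolynomial ι ℂ) : AEStronglyMeasurable (fun ω => eval (Z ω) f) (μ'.map T) :=
    hT.map_eq.symm ▸ (hZ.hasFiniteMoments f).aestronglyMeasurable
  have hfin : HasFiniteMoments (Z ∘ T) μ' := fun f =>
    (integrable_map_measure (hmeas f) hT.aemeasurable).1
      (hT.map_eq.symm ▸ hZ.hasFiniteMoments f)
  have hexp (f : MvPolynomial ι ℂ) :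
      hfin.expectation f = hZ.hasFiniteMoments.expectation f :=
    (integral_map hT.aemeasurable (hmeas f)).symm.trans (by rw [hT.map_eq]; rfl)
  exact ⟨hfin, by simpa only [hexp] using hZ.expectation_X_mul⟩

theorem of_comp {T : Ω' → Ω} (hT : AEMeasurable T μ') (hZ : Measurable Z)
    (h : IsCenteredGaussian (Z ∘ T) C μ') : IsCenteredGaussian Z C (μ'.map T) := by
  have hmeas (f : MvPolynomial ι ℂ) : AEStronglyMeasurable (fun ω => eval (Z ω) f) (μ'.map T) :=
    (f.continuous_eval.measurable.comp hZ).aestronglyMeasurable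
  have hfin : HasFiniteMoments Z (μ'.map T) := fun f =>
    (integrable_map_measure (hmeas f) hT).2 (h.hasFiniteMoments f)
  have hexp (f : MvPolynomial ι ℂ) :
      hfin.expectation f = h.hasFiniteMoments.expectation f := integral_map hT (hmeas f)
  exact ⟨hfin, by simpa only [hexp] using h.expectation_X_mul⟩

theorem mulVec (hZ : IsCenteredGaussian Z C μ) (A : Matrix ι' ι ℂ) :
    IsCenteredGaussian (fun ω => A.mulVec (Z ω)) (A * C * A.transpose) μ := by
  let S : ι' → MvPolynomial ι ℂ := fun b => ∑ c, A b c • X c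
  have heval (ω : Ω) (f : MvPolynomial ι' ℂ) :
      eval (A.mulVec (Z ω)) f = eval (Z ω) (bind₁ S f) := by
    have hS : (fun b => eval (Z ω) (S b)) = A.mulVec (Z ω) := by
      ext b
      simp [S, Matrix.mulVec, dotProduct]
    rw [← hS]
    exact (eval₂Hom_bind₁ _ _ _ _).symm
  have hpderiv (c : ι) (f : MvPolynomial ι' ℂ) :
      pderiv c (bind₁ S f) = ∑ b, A b c • bind₁ S (pderiv b f) := by
    classical
    simp [pderiv_bind₁, S, pderiv_X, Pi.single_apply]
  have hfin : HasFiniteMoments (fun ω => A.mulVec (Z ω)) μ := fun f => by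
    simpa only [heval] using hZ.hasFiniteMoments (bind₁ S f)
  have hexp (f : MvPolynomial ι' ℂ) :
      hfin.expectation f = hZ.hasFiniteMoments.expectation (bind₁ S f) := by
    simp only [HasFiniteMoments.expectation_apply, heval]
  refine ⟨hfin, fun a f => ?_⟩
  simp only [hexp, map_mul, bind₁_X_right, S, sum_mul, smul_mul_assoc, map_sum, map_smul,
    hZ.expectation_X_mul, hpderiv, smul_eq_mul, Matrix.mul_apply, Matrix.transpose_apply, mul_sum]
  rw [sum_comm_cycle]
  refine sum_congr rfl fun b _ => ?_
  rw [sum_comm]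
  exact sum_congr rfl fun d _ => sum_congr rfl fun c _ => by ring

theorem prod [IsProbabilityMeasure μ] [IsProbabilityMeasure μ'] (hZ : IsCenteredGaussian Z C μ)
    (hZ' : IsCenteredGaussian Z' C' μ') :
    IsCenteredGaussian (fun p : Ω × Ω' => Sum.elim (Z p.1) (Z' p.2)) (Matrix.fromBlocks C 0 0 C')
      (μ.prod μ') := by
  have heval (p : Ω × Ω') (f : MvPolynomial ι ℂ) (g : MvPolynomial ι' ℂ) :
      eval (Sum.elim (Z p.1) (Z' p.2)) (rename Sum.inl f * rename Sum.inr g)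
        = eval (Z p.1) f * eval (Z' p.2) g := by
    simp [eval_rename]
  have hfin : HasFiniteMoments (fun p : Ω × Ω' => Sum.elim (Z p.1) (Z' p.2)) (μ.prod μ') := by
    intro F
    induction F using induction_on_rename_mul_rename with
    | add F G hF hG => exact (hF.add hG).congr (.of_forall fun p => by simp)
    | mul f g =>
      simpa only [heval] using (hZ.hasFiniteMoments f).mul_prod (hZ'.hasFiniteMoments g)
  have hexp (f : MvPolynomial ι ℂ) (g : MvPolynomial ι' ℂ) :
      hfin.expectation (rename Sum.inl f * rename Sum.inr g)
        = hZ.hasFiniteMoments.expectation f * hZ'.hasFiniteMoments.expectation g := by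
    simp only [HasFiniteMoments.expectation_apply, heval]
    exact integral_prod_mul (fun ω => eval (Z ω) f) (fun ω => eval (Z' ω) g)
  refine ⟨hfin, fun a F => ?_⟩
  induction F using induction_on_rename_mul_rename with
  | add F G hF hG => simp only [mul_add, map_add, sum_add_distrib, hF, hG]
  | mul f g =>
    rcases a with a | a
    · have hX : X (Sum.inl a) * (rename Sum.inl f * rename Sum.inr g)
          = rename (Sum.inl : ι → ι ⊕ ι') (X a * f) * rename Sum.inr g := by simp [mul_assoc]
      rw [hX, hexp, hZ.expectation_X_mul]
      simp [Derivation.leibniz, pderiv_rename_inl, pderiv_inl_rename_inr, mul_comm (rename _ g),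
        hexp, sum_mul, mul_assoc]
    · have hX : X (Sum.inr a) * (rename Sum.inl f * rename Sum.inr g)
          = rename Sum.inl f * rename (Sum.inr : ι' → ι ⊕ ι') (X a * g) := by
        simp [mul_left_comm]
      rw [hX, hexp, hZ'.expectation_X_mul]
      simp [Derivation.leibniz, pderiv_rename_inr, pderiv_inr_rename_inl, hexp, mul_sum,
        mul_left_comm]

theorem add [IsProbabilityMeasure μ] [IsProbabilityMeasure μ'] {W : Ω' → ι → ℂ}
    {D : Matrix ι ι ℂ} (hZ : IsCenteredGaussian Z C μ) (hW : IsCenteredGaussian W D μ') :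
    IsCenteredGaussian (fun p : Ω × Ω' => Z p.1 + W p.2) (C + D) (μ.prod μ') := by
  classical
  have h := (hZ.prod hW).mulVec (Matrix.fromCols (1 : Matrix ι ι ℂ) (1 : Matrix ι ι ℂ))
  simpa [Matrix.fromCols_mul_fromBlocks, Matrix.transpose_fromCols, Matrix.fromCols_mul_fromRows]
    using h

end IsCenteredGaussian

end CenteredGaussian

section RealGaussian

variable {v : NNReal}

theorem integrable_gaussianReal_iff {E : Type*} [NormedAddCommGroup E] [NormedSpace ℝ E]
    (hv : v ≠ 0) {f : ℝ → E} :
    Integrable f (gaussianReal 0 v) ↔ Integrable fun x => gaussianPDFReal 0 v x • f x := by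
  rw [gaussianReal_of_var_ne_zero 0 hv, integrable_withDensity_iff_integrable_smul'
    (measurable_gaussianPDF 0 v) (by simp [gaussianPDF_lt_top])]
  simp only [toReal_gaussianPDF]

theorem hasDerivAt_gaussianPDFReal (hv : v ≠ 0) (x : ℝ) :
    HasDerivAt (gaussianPDFReal 0 v) (-(v : ℝ)⁻¹ * x * gaussianPDFReal 0 v x) x := by
  have hexp : HasDerivAt (fun x : ℝ => -(x - 0) ^ 2 / (2 * v)) (-(v : ℝ)⁻¹ * x) x := by
    have hv' : (v : ℝ) ≠ 0 := by exact_mod_cast hv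
    convert! ((((hasDerivAt_id x).sub_const 0).pow 2).neg).div_const (2 * (v : ℝ)) using 1
    simp only [neg_mul, Nat.cast_ofNat, id_eq, sub_zero, Nat.add_one_sub_one, pow_one, mul_one]
    field_simp
  rw [gaussianPDFReal_def]
  exact (hexp.exp.const_mul _).congr_deriv (by ring)

theorem integral_smul_gaussianReal {E : Type*} [NormedAddCommGroup E] [NormedSpace ℝ E]
    {f f' : ℝ → E} (hderiv : ∀ x, HasDerivAt f (f' x) x) (hf : Integrable f (gaussianReal 0 v))
    (hf' : Integrable f' (gaussianReal 0 v))
    (hxf : Integrable (fun x => x • f x) (gaussianReal 0 v)) :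
    ∫ x, x • f x ∂gaussianReal 0 v = (v : ℝ) • ∫ x, f' x ∂gaussianReal 0 v := by
  rcases eq_or_ne v 0 with rfl | hv
  · by_cases hE : CompleteSpace E
    · simp
    · simp [integral, hE]
  have hv' : (v : ℝ) ≠ 0 := by exact_mod_cast hv
  have hsub := integral_sub hxf (hf'.smul (v : ℝ))
  simp only [Pi.smul_apply, integral_smul] at hsub
  rw [← sub_eq_zero, ← hsub, integral_gaussianReal_eq_integral_smul hv]
  refine integral_eq_zero_of_hasDerivAt_of_integrable
    (f := fun x => -(v : ℝ) • gaussianPDFReal 0 v x • f x) (fun x => ?_)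
    ((integrable_gaussianReal_iff hv).1 (hxf.sub (hf'.smul (v : ℝ))))
    (((integrable_gaussianReal_iff hv).1 hf).smul (-(v : ℝ)))
  refine (((hasDerivAt_gaussianPDFReal hv x).smul (hderiv x)).const_smul (-(v : ℝ))).congr_deriv ?_
  match_scalars <;> field_simp

theorem integrable_pow_gaussianReal (n : ℕ) :
    Integrable (fun x : ℝ => (x : ℂ) ^ n) (gaussianReal 0 v) := by
  have h := ((memLp_id_gaussianReal' (n : ENNReal) (by simp)).ofReal (K := ℂ)).integrable_norm_pow'
    (μ := gaussianReal 0 v)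
  refine (integrable_norm_iff (by fun_prop)).1 ?_
  simpa [norm_pow] using h

theorem integral_pow_succ_gaussianReal (n : ℕ) : ∫ x, (x : ℂ) ^ (n + 1) ∂gaussianReal 0 v
    = v * (n * ∫ x, (x : ℂ) ^ (n - 1) ∂gaussianReal 0 v) := by
  have h := integral_smul_gaussianReal (v := v) (f := fun x => (x : ℂ) ^ n)
    (f' := fun x => (n : ℂ) * (x : ℂ) ^ (n - 1))
    (fun x => by simpa using (hasDerivAt_pow n (x : ℂ)).comp_ofReal)
    (integrable_pow_gaussianReal n) ((integrable_pow_gaussianReal (n - 1)).const_mul _)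
    (by simpa only [Complex.real_smul, ← pow_succ'] using integrable_pow_gaussianReal (n + 1))
  simpa only [Complex.real_smul, ← pow_succ', integral_const_mul] using h

theorem integral_pow_two_mul_add_one_gaussianReal (k : ℕ) :
    ∫ x, (x : ℂ) ^ (2 * k + 1) ∂gaussianReal 0 v = 0 := by
  induction k with
  | zero => simpa using integral_pow_succ_gaussianReal (v := v) 0
  | succ k ih =>
    rw [integral_pow_succ_gaussianReal, show 2 * (k + 1) - 1 = 2 * k + 1 by omega, ih]
    simp

theorem integral_pow_two_mul_gaussianReal (k : ℕ) :
    ∫ x, (x : ℂ) ^ (2 * k) ∂gaussianReal 0 v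
      = v ^ k * (2 * k).factorial / (2 ^ k * k.factorial) := by
  induction k with
  | zero => simp
  | succ k ih =>
    have hk : (k.factorial : ℂ) ≠ 0 := by exact_mod_cast k.factorial_ne_zero
    rw [show 2 * (k + 1) = 2 * k + 1 + 1 by ring, integral_pow_succ_gaussianReal,
      Nat.add_sub_cancel, ih, Nat.factorial_succ, Nat.factorial_succ, Nat.factorial_succ]
    push_cast
    field_simp
    ring

theorem sum_range_two_mul_of_odd_eq_zero {M : Type*} [AddCommMonoid M] {F : ℕ → M}
    (hF : ∀ k, F (2 * k + 1) = 0) (d : ℕ) :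
    ∑ n ∈ range (2 * d), F n = ∑ k ∈ range d, F (2 * k) := by
  induction d with
  | zero => simp
  | succ d ih =>
    rw [mul_add, mul_one, sum_range_succ, sum_range_succ, ih, hF, add_zero, sum_range_succ]

theorem eval_heatOp (c z : ℂ) (v : NNReal) (q : Polynomial ℂ) :
    (heatOp (v * c ^ 2 / 2) q).eval z = ∫ x, q.eval (z + c * (x : ℂ)) ∂gaussianReal 0 v := by
  have htaylor (x : ℝ) : q.eval (z + c * (x : ℂ)) = ∑ n ∈ range (2 * (q.natDegree + 1)),
      ((Polynomial.hasseDeriv n q).eval z * c ^ n) * (x : ℂ) ^ n := by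
    rw [add_comm, ← Polynomial.taylor_eval, Polynomial.eval_eq_sum_range'
      (n := 2 * (q.natDegree + 1)) (by rw [Polynomial.natDegree_taylor]; omega)]
    simp only [Polynomial.taylor_coeff, mul_pow, mul_assoc]
  have hderiv (k : ℕ) : ((Polynomial.derivative^[2 * k]) q).eval z
      = (2 * k).factorial * (Polynomial.hasseDeriv (2 * k) q).eval z := by
    rw [← Polynomial.factorial_smul_hasseDeriv]
    simp
  simp only [htaylor]
  rw [integral_finsetSum _ fun n _ => (integrable_pow_gaussianReal n).const_mul _]
  simp only [integral_const_mul]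
  rw [sum_range_two_mul_of_odd_eq_zero fun k => by
    rw [integral_pow_two_mul_add_one_gaussianReal, mul_zero]]
  simp only [heatOp, Polynomial.eval_finsetSum, Polynomial.eval_smul, smul_eq_mul, hderiv,
    integral_pow_two_mul_gaussianReal, div_pow, mul_pow, ← pow_mul]
  exact sum_congr rfl fun k _ => by ring

theorem isCenteredGaussian_pi {κ : Type*} [Fintype κ] [DecidableEq κ] (v : κ → NNReal) :
    IsCenteredGaussian (fun (g : κ → ℝ) k => (g k : ℂ)) (Matrix.diagonal fun k => (v k : ℂ))
      (Measure.pi fun k => gaussianReal 0 (v k)) := by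
  have hmonomial (g : κ → ℝ) (m : κ →₀ ℕ) (c : ℂ) :
      eval (fun k => (g k : ℂ)) (monomial m c) = c * ∏ k, (g k : ℂ) ^ m k := by
    rw [eval_monomial, Finsupp.prod_fintype _ _ fun k => pow_zero _]
  have hfin : HasFiniteMoments (fun (g : κ → ℝ) k => (g k : ℂ))
      (Measure.pi fun k => gaussianReal 0 (v k)) := by
    intro f
    induction f using MvPolynomial.induction_on' with
    | monomial m c =>
      simp only [hmonomial]
      exact (Integrable.fintype_prod (f := fun k (x : ℝ) => (x : ℂ) ^ m k)
        fun k => integrable_pow_gaussianReal (m k)).const_mul c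
    | add f g hf hg => exact (hf.add hg).congr (.of_forall fun p => by simp)
  have hexp (m : κ →₀ ℕ) (c : ℂ) : hfin.expectation (monomial m c)
      = c * ∏ k, ∫ x, (x : ℂ) ^ m k ∂gaussianReal 0 (v k) := by
    simp only [HasFiniteMoments.expectation_apply, hmonomial, integral_const_mul]
    rw [integral_fintype_prod_eq_prod (fun k (x : ℝ) => (x : ℂ) ^ m k)]
  refine ⟨hfin, fun a f => ?_⟩
  simp only [Matrix.diagonal_apply, ite_mul, zero_mul, sum_ite_eq, mem_univ, if_true]
  induction f using MvPolynomial.induction_on' with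
  | monomial m c =>
    rw [X, monomial_mul, one_mul, pderiv_monomial, hexp, hexp, ← mul_prod_erase univ _ (mem_univ a),
      ← mul_prod_erase univ _ (mem_univ a)]
    have hne : ∀ k ∈ univ.erase a, (Finsupp.single a 1 + m : κ →₀ ℕ) k
        = (m - Finsupp.single a 1 : κ →₀ ℕ) k := by
      intro k hk
      simp [Finsupp.single_eq_of_ne (ne_of_mem_erase hk)]
    rw [prod_congr rfl fun k hk => by rw [hne k hk]]
    simp only [Finsupp.coe_add, Pi.add_apply, Finsupp.single_eq_same, add_comm 1,
      integral_pow_succ_gaussianReal, Finsupp.coe_tsub, Pi.sub_apply]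
    ring
  | add f g hf hg => simp only [mul_add, map_add, hf, hg]

end RealGaussian

section Determinant

variable {R A n : Type*} [CommRing R] [DecidableEq n]

/-- The matrix `B + X`, where `X` is the matrix of variables. -/
def translatedMvPolynomialX (B : Matrix n n R) : Matrix n n (MvPolynomial (n × n) R) :=
  B.map C + Matrix.mvPolynomialX n n R

theorem map_pderiv_translatedMvPolynomialX (B : Matrix n n R) (i j : n) :
    (translatedMvPolynomialX B).map (pderiv (i, j)) = Matrix.single i j 1 := by
  ext1 a b
  simp [translatedMvPolynomialX, pderiv_X, Pi.single_apply, Matrix.single_apply, eq_comm]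

theorem map_pderiv_updateCol_translatedMvPolynomialX (B : Matrix n n R) (i j k l : n) :
    ((translatedMvPolynomialX B).updateCol j (Pi.single i 1)).map (pderiv (k, l))
      = (Matrix.single k l 1).updateCol j 0 := by
  rw [Matrix.map_updateCol, map_pderiv_translatedMvPolynomialX]
  congr 1
  ext1 a
  by_cases ha : a = i <;> simp [ha]

/-- The permutation matrix of `(i, j) ↦ (j, i)`, which is the covariance of the entries of a GUE
matrix up to normalization. -/
def swapMatrix (n R : Type*) [DecidableEq n] [Zero R] [One R] : Matrix (n × n) (n × n) R :=
  Matrix.of fun p q => if q = p.swap then 1 else 0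

theorem swapMatrix_transpose : (swapMatrix n R).transpose = swapMatrix n R := by
  ext p q
  simp [swapMatrix, eq_comm (a := p), Prod.swap_eq_iff_eq_swap]

variable [Fintype n]

theorem derivation_prod [CommRing A] [Algebra R A] {ι : Type*} [DecidableEq ι]
    (D : Derivation R A A) (s : Finset ι) (f : ι → A) :
    D (∏ i ∈ s, f i) = ∑ i ∈ s, D (f i) * ∏ j ∈ s.erase i, f j := by
  induction s using Finset.induction_on with
  | empty => simp
  | insert a s ha ih =>
    rw [prod_insert ha, D.leibniz, ih, sum_insert ha, erase_insert ha, smul_eq_mul, smul_eq_mul,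
      mul_sum, add_comm, mul_comm (∏ i ∈ s, f i)]
    refine congrArg _ (sum_congr rfl fun i hi => ?_)
    rw [erase_insert_of_ne (ne_of_mem_of_not_mem hi ha).symm,
      prod_insert fun h => ha (mem_of_mem_erase h), mul_left_comm]

theorem derivation_det [CommRing A] [Algebra R A] (D : Derivation R A A) (M : Matrix n n A) :
    D M.det = ∑ j, (M.updateCol j fun i => D (M i j)).det := by
  simp only [Matrix.det_apply, map_sum, Units.smul_def, map_zsmul, derivation_prod, smul_sum]
  rw [sum_comm]
  refine sum_congr rfl fun j _ => sum_congr rfl fun σ _ => ?_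
  rw [← mul_prod_erase univ _ (mem_univ j), Matrix.updateCol_self,
    prod_congr rfl fun k hk => Matrix.updateCol_ne (ne_of_mem_erase hk)]

theorem derivation_det_of_map_eq_single [CommRing A] [Algebra R A] (D : Derivation R A A)
    {M : Matrix n n A} {i j : n} (hM : M.map D = Matrix.single i j 1) :
    D M.det = (M.updateCol j (Pi.single i 1)).det := by
  have hD (a b : n) : D (M a b) = Matrix.single i j 1 a b := congrFun₂ hM a b
  rw [derivation_det, Fintype.sum_eq_single j fun k hk =>
    Matrix.det_eq_zero_of_column_eq_zero k fun a => by simp [hD, hk.symm]]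
  congr 2
  ext a
  simp [hD, Matrix.single_apply, Pi.single_apply, eq_comm]

theorem det_updateCol_updateCol_comm [CommRing A] (M : Matrix n n A) {i j : n} (hij : i ≠ j)
    (u v : n → A) :
    ((M.updateCol i u).updateCol j v).det = -((M.updateCol i v).updateCol j u).det := by
  have hswap : (M.updateCol i u).updateCol j v
      = ((M.updateCol i v).updateCol j u).submatrix id (Equiv.swap i j) := by
    ext a b
    rw [Matrix.submatrix_apply, id]
    rcases eq_or_ne b i with rfl | hbi
    · simp [hij]
    rcases eq_or_ne b j with rfl | hbj
    · simp [hij]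
    rw [Equiv.swap_apply_of_ne_of_ne hbi hbj]
    simp [hbi, hbj]
  rw [hswap, Matrix.det_permute', Equiv.Perm.sign_swap hij]
  simp

theorem eval_det_translatedMvPolynomialX (B : Matrix n n R) (x : n × n → R) :
    eval x (translatedMvPolynomialX B).det = (B + Matrix.of fun i j => x (i, j)).det := by
  rw [RingHom.map_det]
  congr 1
  ext i j
  simp [translatedMvPolynomialX]

theorem pderiv_pderiv_det_translatedMvPolynomialX (B : Matrix n n R) (i k : n) {j l : n}
    (hjl : j ≠ l) : pderiv (k, l) (pderiv (i, j) (translatedMvPolynomialX B).det)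
      = (((translatedMvPolynomialX B).updateCol j (Pi.single i 1)).updateCol l
          (Pi.single k 1)).det := by
  rw [derivation_det_of_map_eq_single _ (map_pderiv_translatedMvPolynomialX B i j),
    derivation_det_of_map_eq_single]
  rw [map_pderiv_updateCol_translatedMvPolynomialX]
  ext1 a b
  rcases eq_or_ne b j with rfl | hb
  · simp [hjl.symm]
  · simp [hb]

theorem pderiv_pderiv_det_translatedMvPolynomialX_same_col (B : Matrix n n R) (i j k : n) :
    pderiv (k, j) (pderiv (i, j) (translatedMvPolynomialX B).det) = 0 := by
  rw [derivation_det_of_map_eq_single _ (map_pderiv_translatedMvPolynomialX B i j),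
    derivation_det]
  refine sum_eq_zero fun b _ => Matrix.det_eq_zero_of_column_eq_zero b fun a => ?_
  have h := congrFun₂ (map_pderiv_updateCol_translatedMvPolynomialX B i j k j) a b
  rw [Matrix.updateCol_self, ← Matrix.map_apply (f := pderiv (k, j)), h]
  rcases eq_or_ne b j with rfl | hb
  · simp
  · simp [hb, hb.symm]

theorem pderiv_pderiv_swap_det_translatedMvPolynomialX (B : Matrix n n R) (i j : n) :
    pderiv (i, j) (pderiv (j, i) (translatedMvPolynomialX B).det)
      = -pderiv (i, i) (pderiv (j, j) (translatedMvPolynomialX B).det) := by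
  rcases eq_or_ne i j with rfl | hij
  · simp [pderiv_pderiv_det_translatedMvPolynomialX_same_col]
  · rw [pderiv_pderiv_det_translatedMvPolynomialX B _ _ hij,
      pderiv_comm, pderiv_pderiv_det_translatedMvPolynomialX B _ _ hij,
      det_updateCol_updateCol_comm _ hij]

theorem swapMatrix_mulVec (x : n × n → R) (p : n × n) :
    (swapMatrix n R).mulVec x p = x p.swap := by
  simp [swapMatrix, Matrix.mulVec, dotProduct]

theorem swapMatrix_mul_self : swapMatrix n R * swapMatrix n R = 1 := by
  ext p q
  simp only [swapMatrix, Matrix.mul_apply, Matrix.of_apply, ite_mul, one_mul, zero_mul,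
    sum_ite_eq', mem_univ, if_true, Prod.swap_swap, Matrix.one_apply, eq_comm]

/-- The entries of the identity matrix, as a vector: the direction of scalar matrix noise. -/
def diagVec (n R : Type*) [DecidableEq n] [Zero R] [One R] (p : n × n) : R :=
  if p.1 = p.2 then 1 else 0

theorem covLaplacian_swapMatrix_apply (f : MvPolynomial (n × n) R) :
    covLaplacian (swapMatrix n R) f = ∑ i, ∑ j, pderiv (i, j) (pderiv (j, i) f) := by
  simp [covLaplacian_apply, swapMatrix, Fintype.sum_prod_type]

theorem covLaplacian_vecMulVec_diagVec_apply (f : MvPolynomial (n × n) R) :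
    covLaplacian (Matrix.vecMulVec (diagVec n R) (diagVec n R)) f
      = ∑ i, ∑ j, pderiv (i, i) (pderiv (j, j) f) := by
  simp [covLaplacian_apply, diagVec, Matrix.vecMulVec_apply, Fintype.sum_prod_type]

theorem covLaplacian_swapMatrix_add_vecMulVec_diagVec (B : Matrix n n R) :
    covLaplacian (swapMatrix n R + Matrix.vecMulVec (diagVec n R) (diagVec n R))
      (translatedMvPolynomialX B).det = 0 := by
  simp [covLaplacian_add, covLaplacian_swapMatrix_apply, covLaplacian_vecMulVec_diagVec_apply,
    pderiv_pderiv_swap_det_translatedMvPolynomialX]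

end Determinant

section Elliptic

variable {Ω Ω' n : Type*} [MeasurableSpace Ω] [MeasurableSpace Ω'] {μ : Measure Ω}
  {μ' : Measure Ω'} {Z : Ω → Matrix n n ℂ} {σ κ : ℂ}

/-- The entries of a complex matrix, followed by their complex conjugates. -/
def entriesConj (M : Matrix n n ℂ) : n × n ⊕ n × n → ℂ :=
  Sum.elim (fun p => M p.1 p.2) fun p => star (M p.1 p.2)

variable [DecidableEq n]

/-- The covariance of `entriesConj Z` for an elliptic random matrix `Z` with `E |Z i j| ^ 2 = σ` and
`E (Z i j * Z j i) = κ`. -/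
def ellipticCov (n : Type*) [DecidableEq n] (σ κ : ℂ) :
    Matrix (n × n ⊕ n × n) (n × n ⊕ n × n) ℂ :=
  Matrix.fromBlocks (κ • swapMatrix n ℂ) (σ • 1) (σ • 1) (star κ • swapMatrix n ℂ)

variable [Fintype n]

/-- `Z` is an elliptic random matrix: its entries are jointly complex Gaussian and centered, with
`E |Z i j| ^ 2 = σ` and `E (Z i j * Z j i) = κ`, all other covariances being zero. The joint law is
encoded by the entries together with their conjugates. -/
def IsElliptic (Z : Ω → Matrix n n ℂ) (σ κ : ℂ) (μ : Measure Ω) : Prop :=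
  IsCenteredGaussian (fun ω => entriesConj (Z ω)) (ellipticCov n σ κ) μ

namespace IsElliptic

theorem smul (hZ : IsElliptic Z σ κ μ) (c : ℂ) :
    IsElliptic (fun ω => c • Z ω) (c * star c * σ) (c ^ 2 * κ) μ := by
  let A : Matrix (n × n ⊕ n × n) (n × n ⊕ n × n) ℂ := Matrix.fromBlocks (c • 1) 0 0 (star c • 1)
  have h := hZ.mulVec A
  have hentries (ω : Ω) : A.mulVec (entriesConj (Z ω)) = entriesConj (c • Z ω) := by
    ext (p | p) <;> simp [A, entriesConj, Matrix.fromBlocks_mulVec, Matrix.smul_mulVec]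
  have hcov : A * ellipticCov n σ κ * A.transpose
      = ellipticCov n (c * star c * σ) (c ^ 2 * κ) := by
    simp only [A, ellipticCov, Matrix.fromBlocks_transpose, Matrix.fromBlocks_multiply,
      Matrix.transpose_smul, Matrix.transpose_one, Matrix.transpose_zero, smul_mul_smul_comm,
      one_mul, mul_one, zero_mul, mul_zero, add_zero, zero_add, star_mul', star_pow]
    congr 2 <;> ring
  rw [hcov] at h
  simp only [hentries] at h
  exact h

theorem add [IsProbabilityMeasure μ] [IsProbabilityMeasure μ'] {W : Ω' → Matrix n n ℂ} {σ' κ' : ℂ}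
    (hZ : IsElliptic Z σ κ μ) (hW : IsElliptic W σ' κ' μ') :
    IsElliptic (fun p : Ω × Ω' => Z p.1 + W p.2) (σ + σ') (κ + κ') (μ.prod μ') := by
  have h := IsCenteredGaussian.add hZ hW
  have hentries (p : Ω × Ω') :
      entriesConj (Z p.1) + entriesConj (W p.2) = entriesConj (Z p.1 + W p.2) := by
    ext (p | p) <;> simp [entriesConj]
  have hcov : ellipticCov n σ κ + ellipticCov n σ' κ' = ellipticCov n (σ + σ') (κ + κ') := by
    simp [ellipticCov, Matrix.fromBlocks_add, add_smul]
  rw [hcov] at h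
  simp only [hentries] at h
  exact h

theorem comp (hZ : IsElliptic Z σ κ μ) {T : Ω' → Ω} (hT : HasLaw T μ μ') :
    IsElliptic (Z ∘ T) σ κ μ' :=
  IsCenteredGaussian.comp hZ hT

theorem integral_trace_conjTranspose_mul_self [IsProbabilityMeasure μ] (hZ : IsElliptic Z σ κ μ) :
    ∫ ω, ((Z ω).conjTranspose * Z ω).trace ∂μ = Fintype.card n ^ 2 * σ := by
  have hint (i j : n) : Integrable (fun ω => star (Z ω i j) * Z ω i j) μ :=
    hZ.integrable_mul (.inr (i, j)) (.inl (i, j))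
  have hcov (i j : n) : ∫ ω, star (Z ω i j) * Z ω i j ∂μ = σ :=
    (hZ.integral_mul (.inr (i, j)) (.inl (i, j))).trans (by simp [ellipticCov])
  simp only [Matrix.trace, Matrix.diag, Matrix.mul_apply, Matrix.conjTranspose_apply]
  rw [integral_finsetSum _ fun j _ => integrable_finsetSum _ fun i _ => hint i j]
  simp only [integral_finsetSum _ fun i _ => hint i _, hcov, sum_const, card_univ, nsmul_eq_mul]
  ring

theorem integral_trace_sq [IsProbabilityMeasure μ] (hZ : IsElliptic Z σ κ μ) :
    ∫ ω, (Z ω ^ 2).trace ∂μ = Fintype.card n ^ 2 * κ := by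
  have hint (i j : n) : Integrable (fun ω => Z ω i j * Z ω j i) μ :=
    hZ.integrable_mul (.inl (i, j)) (.inl (j, i))
  have hcov (i j : n) : ∫ ω, Z ω i j * Z ω j i ∂μ = κ :=
    (hZ.integral_mul (.inl (i, j)) (.inl (j, i))).trans (by simp [ellipticCov, swapMatrix])
  simp only [Matrix.trace, Matrix.diag, sq, Matrix.mul_apply]
  rw [integral_finsetSum _ fun i _ => integrable_finsetSum _ fun j _ => hint i j]
  simp only [integral_finsetSum _ fun j _ => hint _ j, hcov, sum_const, card_univ, nsmul_eq_mul]
  ring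

end IsElliptic

end Elliptic

section DeterminantMoment

variable {Ω Ω₀ n : Type*} [MeasurableSpace Ω] [MeasurableSpace Ω₀] {μ : Measure Ω}
  {μ₀ : Measure Ω₀} [Fintype n] [DecidableEq n]

theorem lintegral_enorm_sq {h : Ω → ℂ} (hi : Integrable (fun ω => h ω * star (h ω)) μ) :
    ∫⁻ ω, ‖h ω‖ₑ ^ 2 ∂μ = ENNReal.ofReal (∫ ω, h ω * star (h ω) ∂μ).re := by
  have hsq (ω : Ω) : h ω * star (h ω) = ((‖h ω‖ ^ 2 : ℝ) : ℂ) := by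
    rw [Complex.star_def, Complex.mul_conj, Complex.normSq_eq_norm_sq]
  simp only [hsq] at hi ⊢
  rw [integral_complex_ofReal, Complex.ofReal_re, ofReal_integral_eq_lintegral_ofReal]
  · simp only [ENNReal.ofReal_pow (norm_nonneg _), ofReal_norm]
  · simpa only [RCLike.re_to_complex, Complex.ofReal_re] using hi.re
  · exact .of_forall fun ω => sq_nonneg _

theorem integral_pi_fin_two_mul_star {α : Type*} [MeasurableSpace α] {ν : Measure α} [SigmaFinite ν]
    (f : α → ℂ) : ∫ x : Fin 2 → α, f (x 0) * star (f (x 1)) ∂(Measure.pi fun _ => ν)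
      = (∫ x, f x ∂ν) * star (∫ x, f x ∂ν) := by
  have h := integral_fintype_prod_eq_prod (μ := fun _ => ν) ![f, fun x => star (f x)]
  simp only [Fin.prod_univ_two, Matrix.cons_val_zero, Matrix.cons_val_one] at h
  exact h.trans (congrArg _ integral_conj)

/-- The polynomial in the entries and conjugate entries of a matrix `M` whose value is
`|det (B + M)| ^ 2`. -/
def normSqDetPoly (B : Matrix n n ℂ) : MvPolynomial (n × n ⊕ n × n) ℂ :=
  rename Sum.inl (translatedMvPolynomialX B).det
    * rename Sum.inr (translatedMvPolynomialX (B.map star)).det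

theorem eval_normSqDetPoly (B : Matrix n n ℂ) (x : n × n ⊕ n × n → ℂ) :
    eval x (normSqDetPoly B) = (B + Matrix.of fun i j => x (.inl (i, j))).det
      * star (B + Matrix.of fun i j => star (x (.inr (i, j)))).det := by
  rw [normSqDetPoly, map_mul, eval_rename, eval_rename, eval_det_translatedMvPolynomialX,
    eval_det_translatedMvPolynomialX, ← starRingEnd_apply, RingHom.map_det]
  congr 2
  ext i j
  simp

theorem covLaplacian_fromBlocks_normSqDetPoly (B : Matrix n n ℂ) (c d : ℂ) :
    covLaplacian (Matrix.fromBlocks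
      (c • (swapMatrix n ℂ + Matrix.vecMulVec (diagVec n ℂ) (diagVec n ℂ))) 0 0
      (d • (swapMatrix n ℂ + Matrix.vecMulVec (diagVec n ℂ) (diagVec n ℂ)))) (normSqDetPoly B)
      = 0 := by
  rw [normSqDetPoly, covLaplacian_fromBlocks_diagonal]
  simp only [covLaplacian_smul, LinearMap.smul_apply, covLaplacian_swapMatrix_add_vecMulVec_diagVec,
    smul_zero, map_zero, zero_mul, mul_zero, add_zero]

/-- The covariance of `entriesConj` for a scalar matrix noise `(β * x) • 1` with `β ^ 2 = c`, where
independent standard real Gaussians `x` are used for the entries and for their conjugates. The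
independence makes the two factors of `|det| ^ 2` see independent noises. -/
def scalarNoiseCov (n : Type*) [DecidableEq n] (c : ℂ) :
    Matrix (n × n ⊕ n × n) (n × n ⊕ n × n) ℂ :=
  Matrix.fromBlocks (c • Matrix.vecMulVec (diagVec n ℂ) (diagVec n ℂ)) 0 0
    (star c • Matrix.vecMulVec (diagVec n ℂ) (diagVec n ℂ))

theorem isCenteredGaussian_scalarNoise (β : ℂ) :
    IsCenteredGaussian (fun x : Fin 2 → ℝ => Sum.elim ((β * (x 0 : ℂ)) • diagVec n ℂ)
      ((star β * (x 1 : ℂ)) • diagVec n ℂ)) (scalarNoiseCov n (β ^ 2))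
      (Measure.pi fun _ => gaussianReal 0 1) := by
  let A : Matrix (n × n ⊕ n × n) (Fin 2) ℂ := Matrix.fromRows
    (Matrix.of fun p => ![β * diagVec n ℂ p, 0]) (Matrix.of fun p => ![0, star β * diagVec n ℂ p])
  have h := (isCenteredGaussian_pi fun _ : Fin 2 => 1).mulVec A
  have hentries (x : Fin 2 → ℝ) : A.mulVec (fun k => (x k : ℂ))
      = Sum.elim ((β * (x 0 : ℂ)) • diagVec n ℂ) ((star β * (x 1 : ℂ)) • diagVec n ℂ) := by
    ext (p | p) <;> simp [A, Matrix.mulVec, dotProduct, mul_right_comm]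
  have hcov : A * (Matrix.diagonal fun _ => ((1 : NNReal) : ℂ) : Matrix (Fin 2) (Fin 2) ℂ)
      * A.transpose = scalarNoiseCov n (β ^ 2) := by
    ext (p | p) (q | q) <;>
      simp [A, scalarNoiseCov, Matrix.mul_apply, Fin.sum_univ_two, Matrix.vecMulVec_apply] <;> ring
  rw [hcov] at h
  simpa only [hentries] using h

theorem eval_entriesConj_normSqDetPoly (B M : Matrix n n ℂ) :
    eval (entriesConj M) (normSqDetPoly B) = (B + M).det * star (B + M).det := by
  rw [eval_normSqDetPoly]
  simp only [entriesConj, Sum.elim_inl, Sum.elim_inr, star_star]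
  rfl

theorem eval_entriesConj_add_normSqDetPoly (B M : Matrix n n ℂ) (c d : ℂ) :
    eval (entriesConj M + Sum.elim (c • diagVec n ℂ) (d • diagVec n ℂ)) (normSqDetPoly B)
      = (B + M + c • 1).det * star (B + M + star d • 1).det := by
  rw [eval_normSqDetPoly, add_assoc, add_assoc]
  congr 4
  all_goals ext i j; by_cases hij : i = j <;> simp [entriesConj, diagVec, hij]

theorem covLaplacian_ellipticCov_normSqDetPoly (B : Matrix n n ℂ) (σ κ κ₀ : ℂ) :
    covLaplacian (ellipticCov n σ κ) (normSqDetPoly B)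
      = covLaplacian (ellipticCov n σ κ₀ + scalarNoiseCov n (κ₀ - κ)) (normSqDetPoly B) := by
  have hcov : ellipticCov n σ κ₀ + scalarNoiseCov n (κ₀ - κ) = ellipticCov n σ κ
      + Matrix.fromBlocks
        ((κ₀ - κ) • (swapMatrix n ℂ + Matrix.vecMulVec (diagVec n ℂ) (diagVec n ℂ))) 0 0
        (star (κ₀ - κ) • (swapMatrix n ℂ + Matrix.vecMulVec (diagVec n ℂ) (diagVec n ℂ))) := by
    simp only [ellipticCov, scalarNoiseCov, Matrix.fromBlocks_add, star_sub, add_zero]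
    congr 1 <;> module
  rw [hcov, covLaplacian_add, LinearMap.add_apply, covLaplacian_fromBlocks_normSqDetPoly, add_zero]

namespace IsElliptic

variable {Z : Ω → Matrix n n ℂ} {Z₀ : Ω₀ → Matrix n n ℂ} {σ κ κ₀ : ℂ}

theorem integrable_det_mul_star_det (hZ : IsElliptic Z σ κ μ) (B : Matrix n n ℂ) :
    Integrable (fun ω => (B + Z ω).det * star (B + Z ω).det) μ :=
  (hZ.hasFiniteMoments (normSqDetPoly B)).congr
    (.of_forall fun ω => eval_entriesConj_normSqDetPoly B (Z ω))

theorem lintegral_enorm_det_add_sq [IsProbabilityMeasure μ] [IsProbabilityMeasure μ₀]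
    (hZ : IsElliptic Z σ κ μ) (hZ₀ : IsElliptic Z₀ σ κ₀ μ₀) {β : ℂ} (hβ : β ^ 2 = κ₀ - κ)
    (B : Matrix n n ℂ) : ∫⁻ ω, ‖(B + Z ω).det‖ₑ ^ 2 ∂μ
      = ∫⁻ ω, ‖∫ x, (B + Z₀ ω + (β * (x : ℂ)) • 1).det ∂gaussianReal 0 1‖ₑ ^ 2 ∂μ₀ := by
  let f (ω : Ω₀) (x : ℝ) : ℂ := (B + Z₀ ω + (β * (x : ℂ)) • 1).det
  have hsum : IsCenteredGaussian (fun p : Ω₀ × (Fin 2 → ℝ) => entriesConj (Z₀ p.1)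
      + Sum.elim ((β * (p.2 0 : ℂ)) • diagVec n ℂ) ((star β * (p.2 1 : ℂ)) • diagVec n ℂ))
      (ellipticCov n σ κ₀ + scalarNoiseCov n (κ₀ - κ))
      (μ₀.prod (Measure.pi fun _ => gaussianReal 0 1)) :=
    hβ ▸ IsCenteredGaussian.add hZ₀ (isCenteredGaussian_scalarNoise β)
  have heval (p : Ω₀ × (Fin 2 → ℝ)) : eval (entriesConj (Z₀ p.1)
      + Sum.elim ((β * (p.2 0 : ℂ)) • diagVec n ℂ) ((star β * (p.2 1 : ℂ)) • diagVec n ℂ))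
      (normSqDetPoly B) = f p.1 (p.2 0) * star (f p.1 (p.2 1)) := by
    simp [eval_entriesConj_add_normSqDetPoly, f]
  have hint : Integrable (fun p : Ω₀ × (Fin 2 → ℝ) => f p.1 (p.2 0) * star (f p.1 (p.2 1)))
      (μ₀.prod (Measure.pi fun _ => gaussianReal 0 1)) :=
    (hsum.hasFiniteMoments (normSqDetPoly B)).congr (.of_forall heval)
  have hinner (ω : Ω₀) :
      ∫ x : Fin 2 → ℝ, f ω (x 0) * star (f ω (x 1)) ∂(Measure.pi fun _ => gaussianReal 0 1)
        = (∫ x, f ω x ∂gaussianReal 0 1) * star (∫ x, f ω x ∂gaussianReal 0 1) :=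
    integral_pi_fin_two_mul_star (f ω)
  have hmoment : ∫ ω, (B + Z ω).det * star (B + Z ω).det ∂μ = ∫ ω, (∫ x, f ω x ∂gaussianReal 0 1)
      * star (∫ x, f ω x ∂gaussianReal 0 1) ∂μ₀ := by
    have h := hZ.expectation_eq hsum (covLaplacian_ellipticCov_normSqDetPoly B σ κ κ₀)
    simp only [HasFiniteMoments.expectation_apply, eval_entriesConj_normSqDetPoly, heval] at h
    rw [h, integral_prod _ hint]
    simp only [hinner]
  rw [lintegral_enorm_sq (hZ.integrable_det_mul_star_det B), hmoment, ← lintegral_enorm_sq]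
  simpa only [hinner] using hint.integral_prod_left

theorem lintegral_enorm_det_sub_sq [IsProbabilityMeasure μ] [IsProbabilityMeasure μ₀]
    (hZ : IsElliptic Z σ κ μ) (hZ₀ : IsElliptic Z₀ σ κ₀ μ₀) (A : Matrix n n ℂ) (z : ℂ) :
    ∫⁻ ω, ‖(z • 1 - (A + Z ω)).det‖ₑ ^ 2 ∂μ
      = ∫⁻ ω, ‖(heatOp ((κ₀ - κ) / 2) (A + Z₀ ω).charpoly).eval z‖ₑ ^ 2 ∂μ₀ := by
  obtain ⟨β, hβ⟩ := IsAlgClosed.exists_pow_nat_eq (κ₀ - κ) two_pos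
  have h := (hZ.smul (-1)).lintegral_enorm_det_add_sq (hZ₀.smul (-1)) (β := β) (by simpa using hβ)
    (z • 1 - A)
  have hcharpoly (ω : Ω₀) (x : ℝ) : (z • 1 - (A + Z₀ ω) + (β * (x : ℂ)) • 1).det
      = (A + Z₀ ω).charpoly.eval (z + β * (x : ℂ)) := by
    rw [Matrix.eval_charpoly, Matrix.scalar_apply, ← Matrix.smul_one_eq_diagonal]
    congr 1
    module
  have hheat (ω : Ω₀) := eval_heatOp β z 1 (A + Z₀ ω).charpoly
  simp only [NNReal.coe_one, Complex.ofReal_one, one_mul, hβ] at hheat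
  simpa only [neg_one_smul, ← sub_eq_add_neg, sub_sub, hcharpoly, hheat] using h

end IsElliptic

end DeterminantMoment

section GUE

variable {Ω : Type*} [MeasurableSpace Ω] {P : Measure Ω} {N : ℕ}

/-- The coefficients of `g (i, j)` (for `false`) and of `g (j, i)` (for `true`) in the `(i, j)`
entry of `hermitianOfCoords N g`. The diagonal entry is the coordinate itself, attributed to
`false`. -/
def hermitianCoeff (N : ℕ) (b : Bool) (p : Fin N × Fin N) : ℂ :=
  if p.1 = p.2 then cond b 0 1
  else if p.1 < p.2 then cond b Complex.I 1 / (Real.sqrt 2 : ℂ)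
  else cond b 1 (-Complex.I) / (Real.sqrt 2 : ℂ)

/-- The matrix of the linear map `g ↦ hermitianOfCoords N g`. -/
def hermitianMatrix (N : ℕ) : Matrix (Fin N × Fin N) (Fin N × Fin N) ℂ :=
  Matrix.diagonal (hermitianCoeff N false)
    + Matrix.diagonal (hermitianCoeff N true) * swapMatrix (Fin N) ℂ

theorem hermitianMatrix_mulVec (g : Fin N × Fin N → ℝ) (p : Fin N × Fin N) :
    (hermitianMatrix N).mulVec (fun q => (g q : ℂ)) p = hermitianOfCoords N g p.1 p.2 := by
  rw [hermitianMatrix, Matrix.add_mulVec, ← Matrix.mulVec_mulVec, Pi.add_apply,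
    Matrix.mulVec_diagonal, Matrix.mulVec_diagonal, swapMatrix_mulVec]
  obtain ⟨i, j⟩ := p
  rcases lt_trichotomy i j with h | rfl | h
  · simp only [hermitianCoeff, h.ne, ↓reduceIte, h, cond_false, one_div, cond_true,
        Prod.swap_prod_mk, hermitianOfCoords, Matrix.of_apply]
    ring
  · simp [hermitianCoeff, hermitianOfCoords]
  · simp only [hermitianCoeff, h.ne', ↓reduceIte, h.not_gt, cond_false, cond_true, one_div,
        Prod.swap_prod_mk, hermitianOfCoords, Matrix.of_apply]
    ring

theorem hermitianMatrix_mul_transpose_apply (p q : Fin N × Fin N) :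
    (hermitianMatrix N * (hermitianMatrix N).transpose) p q
      = (if p = q then hermitianCoeff N false p ^ 2 + hermitianCoeff N true p ^ 2 else 0)
        + if q = p.swap then hermitianCoeff N false p * hermitianCoeff N true q
          + hermitianCoeff N true p * hermitianCoeff N false q else 0 := by
  have hprod : hermitianMatrix N * (hermitianMatrix N).transpose
      = Matrix.diagonal (fun p => hermitianCoeff N false p ^ 2 + hermitianCoeff N true p ^ 2)
        + (Matrix.diagonal (hermitianCoeff N false) * swapMatrix (Fin N) ℂ
            * Matrix.diagonal (hermitianCoeff N true)
          + Matrix.diagonal (hermitianCoeff N true) * swapMatrix (Fin N) ℂ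
            * Matrix.diagonal (hermitianCoeff N false)) := by
    simp only [hermitianMatrix, Matrix.transpose_add, Matrix.transpose_mul,
      Matrix.diagonal_transpose, swapMatrix_transpose, add_mul, mul_add, sq, mul_assoc,
      ← Matrix.diagonal_add, ← Matrix.diagonal_mul_diagonal]
    rw [← mul_assoc (swapMatrix (Fin N) ℂ) (swapMatrix (Fin N) ℂ), swapMatrix_mul_self, one_mul]
    abel
  rw [hprod]
  simp only [swapMatrix, Matrix.add_apply, Matrix.diagonal_apply, Matrix.mul_diagonal,
      Matrix.diagonal_mul, Matrix.of_apply, mul_ite, mul_one, mul_zero, ite_mul, zero_mul,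
      add_right_inj]
  split_ifs <;> simp

theorem hermitianMatrix_mul_transpose :
    hermitianMatrix N * (hermitianMatrix N).transpose = swapMatrix (Fin N) ℂ := by
  have hsqrt : ((Real.sqrt 2 : ℝ) : ℂ) ^ 2 = 2 := by
    rw [← Complex.ofReal_pow, Real.sq_sqrt zero_le_two, Complex.ofReal_ofNat]
  have hsq (p : Fin N × Fin N) (hp : p.1 ≠ p.2) :
      hermitianCoeff N false p ^ 2 + hermitianCoeff N true p ^ 2 = 0 := by
    rcases hp.lt_or_gt with h | h
    · norm_num [hermitianCoeff, h.ne, h, div_pow, hsqrt]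
    · norm_num [hermitianCoeff, h.ne', h.not_gt, div_pow, hsqrt]
  have hcross (p : Fin N × Fin N) (hp : p.1 ≠ p.2) :
      hermitianCoeff N false p * hermitianCoeff N true p.swap
        + hermitianCoeff N true p * hermitianCoeff N false p.swap = 1 := by
    rcases hp.lt_or_gt with h | h
    · norm_num [hermitianCoeff, h.ne, h.ne', h, h.not_gt, div_mul_div_comm, ← sq, hsqrt]
    · norm_num [hermitianCoeff, h.ne, h.ne', h, h.not_gt, div_mul_div_comm, ← sq, hsqrt]
  ext p q
  rw [hermitianMatrix_mul_transpose_apply, swapMatrix, Matrix.of_apply]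
  by_cases hp : p.1 = p.2
  · obtain ⟨i, j⟩ := p
    obtain rfl : i = j := hp
    by_cases hq : q = (i, i)
    · simp [hermitianCoeff, hq]
    · simp [hq, Ne.symm hq]
  · rw [hsq p hp, ite_self, zero_add]
    split_ifs with hq
    · rw [hq, hcross p hp]
    · rfl

theorem star_hermitianOfCoords (g : Fin N × Fin N → ℝ) (i j : Fin N) :
    star (hermitianOfCoords N g i j) = hermitianOfCoords N g j i := by
  rcases lt_trichotomy i j with h | rfl | h
  · simp [hermitianOfCoords, h.ne, h.ne', h, h.not_gt, sub_eq_add_neg]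
  · simp [hermitianOfCoords]
  · simp [hermitianOfCoords, h.ne, h.ne', h, h.not_gt, sub_eq_add_neg]

theorem isElliptic_hermitianOfCoords (v : NNReal) :
    IsElliptic (hermitianOfCoords N) v v (Measure.pi fun _ => gaussianReal 0 v) := by
  let A : Matrix (Fin N × Fin N ⊕ Fin N × Fin N) (Fin N × Fin N) ℂ :=
    Matrix.fromRows (hermitianMatrix N) (swapMatrix (Fin N) ℂ * hermitianMatrix N)
  have h := (isCenteredGaussian_pi fun _ : Fin N × Fin N => v).mulVec A
  have hentries (g : Fin N × Fin N → ℝ) :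
      A.mulVec (fun q => (g q : ℂ)) = entriesConj (hermitianOfCoords N g) := by
    ext (p | p)
    · simp [A, entriesConj, hermitianMatrix_mulVec]
    · simp [A, entriesConj, ← Matrix.mulVec_mulVec, swapMatrix_mulVec, hermitianMatrix_mulVec,
        ← star_hermitianOfCoords g p.1]
  have hcov : A * (Matrix.diagonal fun _ => (v : ℂ) : Matrix (Fin N × Fin N) (Fin N × Fin N) ℂ)
      * A.transpose = ellipticCov (Fin N) v v := by
    have hA : A * A.transpose = ellipticCov (Fin N) 1 1 := by
      have hswap :
          hermitianMatrix N * ((hermitianMatrix N).transpose * swapMatrix (Fin N) ℂ) = 1 := by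
        rw [← mul_assoc, hermitianMatrix_mul_transpose, swapMatrix_mul_self]
      simp only [A, Matrix.transpose_fromRows, Matrix.fromRows_mul_fromCols, Matrix.transpose_mul,
        swapMatrix_transpose, ellipticCov, mul_assoc, hermitianMatrix_mul_transpose, hswap,
        swapMatrix_mul_self, mul_one, one_smul, star_one]
    rw [← Matrix.smul_one_eq_diagonal]
    simp [Matrix.mul_smul, hA, ellipticCov, Matrix.fromBlocks_smul]
  rw [hcov] at h
  simp only [hentries] at h
  exact h

instance : BorelSpace (Matrix (Fin N) (Fin N) ℂ) :=
  inferInstanceAs (BorelSpace (Fin N → Fin N → ℂ))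

instance : SecondCountableTopology (Matrix (Fin N) (Fin N) ℂ) :=
  inferInstanceAs (SecondCountableTopology (Fin N → Fin N → ℂ))

theorem continuous_entriesConj : Continuous (entriesConj : Matrix (Fin N) (Fin N) ℂ → _) := by
  refine continuous_pi fun p => ?_
  rcases p with p | p
  · exact continuous_id.matrix_elem p.1 p.2
  · exact (continuous_id.matrix_elem p.1 p.2).star

theorem continuous_hermitianOfCoords : Continuous (hermitianOfCoords N) := by
  refine continuous_matrix fun i j => ?_
  simp only [hermitianOfCoords, Matrix.of_apply]
  split_ifs <;> fun_prop

instance : IsProbabilityMeasure (gueLaw N) :=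
  Measure.isProbabilityMeasure_map continuous_hermitianOfCoords.aemeasurable

theorem IsElliptic.of_comp {T : Ω → Matrix (Fin N) (Fin N) ℂ} {σ κ : ℂ} (hT : AEMeasurable T P)
    (h : IsElliptic T σ κ P) : IsElliptic id σ κ (P.map T) :=
  IsCenteredGaussian.of_comp hT continuous_entriesConj.measurable h

theorem isElliptic_gueLaw : IsElliptic id (((N : NNReal)⁻¹ : NNReal) : ℂ)
    (((N : NNReal)⁻¹ : NNReal) : ℂ) (gueLaw N) :=
  .of_comp continuous_hermitianOfCoords.aemeasurable (isElliptic_hermitianOfCoords _)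

theorem exists_isElliptic_rotatedEllipticLaw (θ a b : ℝ) :
    ∃ σ κ : ℂ, IsElliptic id σ κ (rotatedEllipticLaw N θ a b) :=
  ⟨_, _, .of_comp (by fun_prop) (((isElliptic_gueLaw.smul a).add
    (isElliptic_gueLaw.smul (Complex.I * b))).smul (Complex.exp (Complex.I * θ)))⟩

namespace IsRotatedElliptic

variable {Z : Ω → Matrix (Fin N) (Fin N) ℂ} {s : ℝ} {τ : ℂ}

theorem aemeasurable (hZ : IsRotatedElliptic P Z s τ) : AEMeasurable Z P :=
  let ⟨_, _, _, _, hlaw⟩ := hZ.hasLaw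
  hlaw.aemeasurable

theorem isElliptic [IsProbabilityMeasure P] (hZ : IsRotatedElliptic P Z s τ) (hN : 0 < N) :
    IsElliptic Z (s / N) ((s - τ) / N) P := by
  obtain ⟨θ, a, b, -, hlaw⟩ := hZ.hasLaw
  obtain ⟨σ, κ, h⟩ := exists_isElliptic_rotatedEllipticLaw (N := N) θ a b
  have hZell : IsElliptic Z σ κ P := h.comp hlaw
  have hN' : (N : ℂ) ≠ 0 := by exact_mod_cast hN.ne'
  have hs := hZ.variance_eq
  have hτ := hZ.covariance_eq
  rw [integral_const_mul, hZell.integral_trace_conjTranspose_mul_self, Fintype.card_fin] at hs hτ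
  rw [integral_const_mul, hZell.integral_trace_sq, Fintype.card_fin] at hτ
  have hσ : σ = s / N := by
    rw [hs]
    field_simp
  have hκ : κ = (s - τ) / N := by
    rw [hs, hτ]
    field_simp
    ring
  rwa [hσ, hκ] at hZell

end IsRotatedElliptic

end GUE

section Main

theorem measurable_eval_heatOp_charpoly {N : ℕ} (c z : ℂ) :
    Measurable fun M : Matrix (Fin N) (Fin N) ℂ => (heatOp c M.charpoly).eval z := by
  obtain ⟨β, hβ⟩ := IsAlgClosed.exists_pow_nat_eq (2 * c) two_pos
  have hheat (M : Matrix (Fin N) (Fin N) ℂ) : (heatOp c M.charpoly).eval z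
      = ∫ x, (Matrix.scalar (Fin N) (z + β * ((x : ℝ) : ℂ)) - M).det ∂gaussianReal 0 1 := by
    simpa [hβ, Matrix.eval_charpoly] using eval_heatOp β z 1 M.charpoly
  have hcont : Continuous fun p : Matrix (Fin N) (Fin N) ℂ × ℝ =>
      (Matrix.scalar (Fin N) (z + β * (p.2 : ℂ)) - p.1).det := by
    simp only [Matrix.scalar_apply]
    fun_prop
  simp only [hheat]
  exact (StronglyMeasurable.integral_prod_right hcont.measurable.stronglyMeasurable).measurable

theorem lintegral_comp_of_indepFun {Ω α β : Type*} [MeasurableSpace Ω] [MeasurableSpace α]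
    [MeasurableSpace β] {P : Measure Ω} [IsFiniteMeasure P] {X : Ω → α} {Y : Ω → β}
    (hX : AEMeasurable X P) (hY : AEMeasurable Y P) (hXY : IndepFun X Y P) {F : α → β → ENNReal}
    (hF : Measurable (Function.uncurry F)) :
    ∫⁻ ω, F (X ω) (Y ω) ∂P = ∫⁻ x, ∫⁻ ω, F x (Y ω) ∂P ∂P.map X := by
  have hpair : ∫⁻ ω, F (X ω) (Y ω) ∂P
      = ∫⁻ p, Function.uncurry F p ∂P.map fun ω => (X ω, Y ω) :=
    (lintegral_map' hF.aemeasurable (hX.prodMk hY)).symm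
  have hinner (x : α) : ∫⁻ ω, F x (Y ω) ∂P = ∫⁻ y, F x y ∂P.map Y :=
    (lintegral_map' hF.of_uncurry_left.aemeasurable hY).symm
  rw [hpair, (indepFun_iff_map_prod_eq_prod_map_map hX hY).1 hXY,
    lintegral_prod _ hF.aemeasurable]
  simp only [hinner, Function.uncurry_apply_pair]

end Main

end

theorem mainTheorem1 {Ω : Type*} [MeasurableSpace Ω] (P : Measure Ω) [IsProbabilityMeasure P]
    (N : ℕ) (hN : 0 < N) (s : ℝ) (hs : 0 < s) (τ₀ τ : ℂ)
    (hτ₀ : ‖τ₀ - (s : ℂ)‖ ≤ s) (hτ : ‖τ - (s : ℂ)‖ ≤ s)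
    (X₀ Zτ₀ Zτ : Ω → Matrix (Fin N) (Fin N) ℂ)
    (hX₀ : AEMeasurable X₀ P)
    (hZτ₀ : IsRotatedElliptic P Zτ₀ s τ₀) (hZτ : IsRotatedElliptic P Zτ s τ)
    (hindep₀ : IndepFun X₀ Zτ₀ P) (hindep : IndepFun X₀ Zτ P) (z : ℂ) :
    ∫⁻ ω, ‖(z • (1 : Matrix (Fin N) (Fin N) ℂ) - (X₀ ω + Zτ ω)).det‖ₑ ^ 2 ∂P
      = ∫⁻ ω, ‖(heatOp ((τ - τ₀) / (2 * (N : ℂ))) (X₀ ω + Zτ₀ ω).charpoly).eval z‖ₑ ^ 2 ∂P := by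
  have hdet : Measurable (Function.uncurry fun A M : Matrix (Fin N) (Fin N) ℂ =>
      ‖(z • (1 : Matrix (Fin N) (Fin N) ℂ) - (A + M)).det‖ₑ ^ 2) :=
    (Continuous.matrix_det (by fun_prop)).measurable.enorm.pow_const 2
  have hheat : Measurable (Function.uncurry fun A M : Matrix (Fin N) (Fin N) ℂ =>
      ‖(heatOp ((τ - τ₀) / (2 * (N : ℂ))) (A + M).charpoly).eval z‖ₑ ^ 2) :=
    ((measurable_eval_heatOp_charpoly _ z).comp measurable_add).enorm.pow_const 2
  have htime : (τ - τ₀) / (2 * (N : ℂ)) = ((s - τ₀) / N - (s - τ) / N) / 2 := by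
    ring
  calc
    _ = ∫⁻ A, ∫⁻ ω, ‖(z • 1 - (A + Zτ ω)).det‖ₑ ^ 2 ∂P ∂P.map X₀ :=
      lintegral_comp_of_indepFun hX₀ hZτ.aemeasurable hindep hdet
    _ = ∫⁻ A, ∫⁻ ω, ‖(heatOp ((τ - τ₀) / (2 * (N : ℂ))) (A + Zτ₀ ω).charpoly).eval z‖ₑ ^ 2 ∂P
          ∂P.map X₀ := by
      refine lintegral_congr fun A => ?_
      rw [htime, (hZτ.isElliptic hN).lintegral_enorm_det_sub_sq (hZτ₀.isElliptic hN)]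
    _ = _ := (lintegral_comp_of_indepFun hX₀ hZτ₀.aemeasurable hindep₀ hheat).symm
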